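/- Let $k$ be an algebraically closed field of characteristic $0$ with the trivial absolute value, let $0<r<1$, and let $k((S))$ carry the $S$-adic absolute value with $|S|=r$. Let $(M,\nabla)$ be a nonzero differential module over $(k((S)),S\frac{d}{dS})$, i.e. $M\neq 0$ is a finite-dimensional $k((S))$-vector space and $\nabla:M\to M$ is a $k$-linear map with $\nabla(fm)=S\frac{df}{dS}\,m+f\nabla(m)$ for all $f\in k((S))$, $m\in M$. Suppose that $(M,\nabla)$ is regular singular, i.e. that there is a basis $(e_j)$ of $M$ over $k((S))$ such that the matrix $G$ of $\nabla$ in it (the $j$-th column of $G$ is $\nabla(e_j)$) has entries in $k$, and let $\{a_1,\dots,a_N\}\subset k$ be the set of eigenvalues of such a matrix $G$. Equip $M$ with the maximum norm of the coordinates in any basis of $M$ over $k((S))$, and let $\mathcal L_k(M)$ be the $k$-algebra of bounded $k$-linear endomorphisms of $M$, with the operator norm; $\nabla$ belongs to it. Points of the analytic affine line $\mathbb A^{1,\mathrm{an}}_k$ are the multiplicative ultrametric seminorms on $k[T]$ that extend the absolute value of $k$; $\mathscr H(x)$ is the completed residue field of such a point $x$ and $T(x)\in\mathscr H(x)$ is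 the image of $T$. For $c\in k$ and $\rho\ge 0$, let $x_{c,\rho}$ be the point $\sum_i \alpha_i(T-c)^i\mapsto\max_i|\alpha_i|\rho^i$, and identify $c\in k$ with $x_{c,0}$. The (Berkovich) spectrum of $\nabla$ is the set $\Sigma_{\nabla,k}(\mathcal L_k(M))$ of the points $x$ such that $\nabla\otimes1-1\otimes T(x)$ is not invertible in $\mathcal L_k(M)\hat\otimes_k\mathscr H(x)$, the completion of the tensor product for the seminorm $f\mapsto\inf\{\max_i\|\varphi_i\|\,|h_i| : f=\sum_i\varphi_i\otimes h_i\}$. Then $$\Sigma_{\nabla,k}(\mathcal L_k(M))=\bigcup_{i=1}^{N}(a_i+\mathbb Z)\cup\{x_{0,1}\}.$$ -/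

import Mathlib

open scoped LaurentSeries TensorProduct NNReal Polynomial

noncomputable section

namespace BerkSpec

/-! ### The projective tensor norm and the completed tensor product -/

section Tensor

variable (k A B : Type*) [NormedField k] [NormedRing A] [NormedAlgebra k A]
  [NormedRing B] [NormedAlgebra k B]

/-- The tensor seminorm on `A ⊗[k] B`: the infimum of `max_i ‖a_i‖ * ‖b_i‖` over all the
presentations `t = ∑ i, a_i ⊗ b_i`. -/
def tensorNormFun (t : A ⊗[k] B) : ℝ :=
  sInf {C : ℝ | ∃ (n : ℕ) (a : Fin n → A) (b : Fin n → B),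
    t = ∑ i, a i ⊗ₜ[k] b i ∧ C = ⨆ i, ‖a i‖ * ‖b i‖}

variable {A B}

lemma tensorNormFun_nonneg (t : A ⊗[k] B) : 0 ≤ tensorNormFun k A B t := by
  apply Real.sInf_nonneg
  rintro _ ⟨n, a, b, -, rfl⟩
  exact Real.iSup_nonneg fun i => by positivity

lemma tensorNormFun_le {ι : Type*} [Fintype ι] (a : ι → A) (b : ι → B) {C : ℝ} (hC : 0 ≤ C)
    (h : ∀ i, ‖a i‖ * ‖b i‖ ≤ C) : tensorNormFun k A B (∑ i, a i ⊗ₜ[k] b i) ≤ C := by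
  have e := Fintype.equivFin ι
  refine le_trans (csInf_le ⟨0, ?_⟩
    ⟨Fintype.card ι, a ∘ e.symm, b ∘ e.symm, ?_, rfl⟩) ?_
  · rintro _ ⟨n, a, b, -, rfl⟩
    exact Real.iSup_nonneg fun i => by positivity
  · exact (e.symm.sum_comp (fun i => a i ⊗ₜ[k] b i)).symm
  · exact Real.iSup_le (fun i => h _) hC

lemma exists_rep_lt (t : A ⊗[k] B) {C : ℝ} (h : tensorNormFun k A B t < C) :
    ∃ (n : ℕ) (a : Fin n → A) (b : Fin n → B),
      t = ∑ i, a i ⊗ₜ[k] b i ∧ ∀ i, ‖a i‖ * ‖b i‖ ≤ C := by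
  have hne : {C : ℝ | ∃ (n : ℕ) (a : Fin n → A) (b : Fin n → B),
      t = ∑ i, a i ⊗ₜ[k] b i ∧ C = ⨆ i, ‖a i‖ * ‖b i‖}.Nonempty := by
    obtain ⟨s, hs⟩ := TensorProduct.exists_finset t
    refine ⟨_, s.card, fun i => (s.equivFin.symm i).1.1, fun i => (s.equivFin.symm i).1.2,
      ?_, rfl⟩
    rw [hs, ← Finset.sum_coe_sort]
    exact (s.equivFin.symm.sum_comp (fun i => i.1.1 ⊗ₜ[k] i.1.2)).symm
  obtain ⟨_, ⟨n, a, b, hab, rfl⟩, hlt⟩ := exists_lt_of_csInf_lt hne h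
  exact ⟨n, a, b, hab, fun i =>
    (le_ciSup (f := fun i => ‖a i‖ * ‖b i‖) (Set.finite_range _).bddAbove i).trans hlt.le⟩

variable (A B)

/-- The tensor seminorm as a submultiplicative seminorm on the `k`-algebra `A ⊗[k] B`. -/
def tensorSeminorm : RingSeminorm (A ⊗[k] B) where
  toFun := tensorNormFun k A B
  map_zero' := by
    refine le_antisymm ?_ (tensorNormFun_nonneg k _)
    simpa using tensorNormFun_le k (A := A) (B := B) (ι := Fin 0) (fun _ => 0) (fun _ => 0)
      le_rfl (by simp)
  add_le' s t := by
    refine le_of_forall_pos_le_add fun ε hε => ?_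
    obtain ⟨n, a, b, rfl, h⟩ := exists_rep_lt k s (lt_add_of_pos_right _ (half_pos hε))
    obtain ⟨m, a', b', rfl, h'⟩ := exists_rep_lt k t (lt_add_of_pos_right _ (half_pos hε))
    have h1 := tensorNormFun_nonneg k (∑ i, a i ⊗ₜ[k] b i)
    have h2 := tensorNormFun_nonneg k (∑ i, a' i ⊗ₜ[k] b' i)
    have := tensorNormFun_le k (Sum.elim a a') (Sum.elim b b')
      (C := tensorNormFun k A B (∑ i, a i ⊗ₜ[k] b i)
        + tensorNormFun k A B (∑ i, a' i ⊗ₜ[k] b' i) + ε) (by positivity) (by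
        rintro (i | i)
        · exact (h i).trans (by linarith)
        · exact (h' i).trans (by linarith))
    simpa [Fintype.sum_sum_type] using this
  neg' t := by
    have key : ∀ t : A ⊗[k] B, tensorNormFun k A B (-t) ≤ tensorNormFun k A B t := by
      intro t
      refine le_of_forall_pos_le_add fun ε hε => ?_
      obtain ⟨n, a, b, rfl, h⟩ := exists_rep_lt k t (lt_add_of_pos_right _ hε)
      have h1 := tensorNormFun_nonneg k (∑ i, a i ⊗ₜ[k] b i)
      have := tensorNormFun_le k (fun i => - a i) b
        (C := tensorNormFun k A B (∑ i, a i ⊗ₜ[k] b i) + ε) (by positivity) (by simpa using h)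
      simpa [TensorProduct.neg_tmul] using this
    exact le_antisymm (key t) (by simpa using key (-t))
  mul_le' s t := by
    have key : ∀ ε : ℝ, 0 < ε → tensorNormFun k A B (s * t) ≤
        (tensorNormFun k A B s + ε) * (tensorNormFun k A B t + ε) := by
      intro ε hε
      obtain ⟨n, a, b, hs, h⟩ := exists_rep_lt k s (lt_add_of_pos_right _ hε)
      obtain ⟨m, a', b', ht, h'⟩ := exists_rep_lt k t (lt_add_of_pos_right _ hε)
      have h1 := tensorNormFun_nonneg k s
      have h2 := tensorNormFun_nonneg k t
      have := tensorNormFun_le k (fun p : Fin n × Fin m => a p.1 * a' p.2)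
        (fun p => b p.1 * b' p.2)
        (C := (tensorNormFun k A B s + ε) * (tensorNormFun k A B t + ε)) (by positivity) (by
          rintro ⟨i, j⟩
          calc ‖a i * a' j‖ * ‖b i * b' j‖ ≤ (‖a i‖ * ‖a' j‖) * (‖b i‖ * ‖b' j‖) := by
                gcongr <;> exact norm_mul_le _ _
            _ = (‖a i‖ * ‖b i‖) * (‖a' j‖ * ‖b' j‖) := by ring
            _ ≤ _ := by gcongr; exacts [h i, h' j])
      have e : s * t = ∑ p : Fin n × Fin m, (a p.1 * a' p.2) ⊗ₜ[k] (b p.1 * b' p.2) := by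
        rw [hs, ht, Finset.sum_mul_sum, Fintype.sum_prod_type]
        simp
      rwa [← e] at this
    have hc : Filter.Tendsto (fun ε : ℝ => (tensorNormFun k A B s + ε) *
        (tensorNormFun k A B t + ε)) (nhdsWithin 0 (Set.Ioi 0))
        (nhds ((tensorNormFun k A B s + 0) * (tensorNormFun k A B t + 0))) :=
      (Continuous.tendsto (by fun_prop) 0).mono_left nhdsWithin_le_nhds
    rw [add_zero, add_zero] at hc
    exact ge_of_tendsto hc (Filter.eventually_of_mem self_mem_nhdsWithin fun ε hε => key ε hε)

/-- The algebra `A ⊗[k] B`, to be equipped with the tensor seminorm. -/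
def NormedTensor : Type _ := A ⊗[k] B

instance : Ring (NormedTensor k A B) := inferInstanceAs (Ring (A ⊗[k] B))

instance : SeminormedRing (NormedTensor k A B) :=
  RingSeminorm.toSeminormedRing (R := NormedTensor k A B) (tensorSeminorm k A B)

/-- The completed tensor product `A ⊗̂ B` over `k`. -/
abbrev CompletedTensor : Type _ := UniformSpace.Completion (NormedTensor k A B)

variable {A B}

/-- The image of `t : A ⊗[k] B` in the completed tensor product. -/
def toCompletedTensor (t : A ⊗[k] B) : CompletedTensor k A B :=
  ((show NormedTensor k A B from t : NormedTensor k A B) : CompletedTensor k A B)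

end Tensor

/-! ### The Berkovich affine line -/

section AffineLine

/-- A point of the analytic affine line over `k`: a multiplicative (ultrametric) seminorm on
`k[T]` whose restriction to `k` is the absolute value of `k`. -/
@[ext] structure AffineLine (k : Type*) [NormedField k] where
  /-- the seminorm -/
  val : Valuation k[X] ℝ≥0
  /-- it extends the absolute value of `k` -/
  val_C : ∀ a : k, val (Polynomial.C a) = ‖a‖₊

variable {k : Type*} [NormedField k]

/-- The seminorm induced by `x` on the fraction field of `k[T] ⧸ 𝔭_x`, where `𝔭_x` is the
kernel of `x`. -/
def AffineLine.fracVal (x : AffineLine k) : Valuation (FractionRing (k[X] ⧸ x.val.supp)) ℝ≥0 :=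
  (x.val.onQuot le_rfl).extendToLocalization (S := nonZeroDivisors (k[X] ⧸ x.val.supp)) (by
    intro s hs
    have h : (x.val.onQuot le_rfl).supp = ⊥ := by
      rw [Valuation.supp_quot, Ideal.map_quotient_self]
    change s ∉ (x.val.onQuot le_rfl).supp
    rw [h]
    exact nonZeroDivisors.ne_zero hs) _

/-- The absolute value induced by `x` on the fraction field of `k[T] ⧸ 𝔭_x`. -/
def AffineLine.fracAbs (x : AffineLine k) :
    AbsoluteValue (FractionRing (k[X] ⧸ x.val.supp)) ℝ where
  toFun z := (x.fracVal z : ℝ)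
  map_mul' := by simp
  nonneg' z := NNReal.coe_nonneg _
  eq_zero' z := by simp
  add_le' y z := by
    have h : x.fracVal (y + z) ≤ x.fracVal y + x.fracVal z :=
      (x.fracVal.map_add y z).trans (max_le_add_of_nonneg zero_le zero_le)
    exact_mod_cast h

/-- The completed residue field `ℋ(x)`. -/
def AffineLine.ResidueField (x : AffineLine k) : Type _ := x.fracAbs.Completion

instance (x : AffineLine k) : NormedField x.ResidueField :=
  inferInstanceAs (NormedField x.fracAbs.Completion)

instance (x : AffineLine k) : CompleteSpace x.ResidueField :=
  inferInstanceAs (CompleteSpace x.fracAbs.Completion)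

/-- The canonical character `k[T] → ℋ(x)`, `P ↦ P(x)`. -/
def AffineLine.character (x : AffineLine k) : k[X] →+* x.ResidueField :=
  (UniformSpace.Completion.coeRingHom (α := WithAbs x.fracAbs)).comp <|
    ((WithAbs.equiv x.fracAbs).symm : _ →+* WithAbs x.fracAbs).comp <|
      (algebraMap (k[X] ⧸ x.val.supp) (FractionRing (k[X] ⧸ x.val.supp))).comp
        (Ideal.Quotient.mk x.val.supp)

lemma AffineLine.norm_character (x : AffineLine k) (P : k[X]) :
    ‖x.character P‖ = x.val P := by
  have h : ‖x.character P‖ = x.fracAbs (algebraMap (k[X] ⧸ x.val.supp)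
      (FractionRing (k[X] ⧸ x.val.supp)) (Ideal.Quotient.mk x.val.supp P)) :=
    UniformSpace.Completion.norm_coe (E := WithAbs x.fracAbs) _
  rw [h]
  change ((x.fracVal _ : ℝ≥0) : ℝ) = _
  rw [AffineLine.fracVal, Valuation.extendToLocalization_apply_map_apply]
  rfl

instance (x : AffineLine k) : NormedAlgebra k x.ResidueField where
  __ := (x.character.comp Polynomial.C).toAlgebra
  norm_smul_le a z := by
    change ‖x.character (Polynomial.C a) * z‖ ≤ _
    rw [norm_mul, x.norm_character, x.val_C, coe_nnnorm]

/-- The point `x_{c,ρ}`: the seminorm `∑ a_i (T - c)^i ↦ max_i |a_i| ρ^i`. -/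
def AffineLine.point [IsUltrametricDist k] (c : k) (ρ : ℝ≥0) : AffineLine k where
  val :=
    { toFun := fun P => ⟨(Polynomial.taylor c P).gaussNorm (NormedField.toAbsoluteValue k) ρ,
        Polynomial.gaussNorm_nonneg _ _ ρ.2⟩
      map_zero' := by
        apply NNReal.eq
        change Polynomial.gaussNorm _ _ _ = 0
        simp
      map_one' := by
        apply NNReal.eq
        change Polynomial.gaussNorm _ _ _ = 1
        have := Polynomial.gaussNorm_C (v := NormedField.toAbsoluteValue k) (ρ : ℝ) 1
        simpa using this
      map_mul' := fun P Q => by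
        apply NNReal.eq
        change Polynomial.gaussNorm _ _ _ = Polynomial.gaussNorm _ _ _ * Polynomial.gaussNorm _ _ _
        have hna : IsNonarchimedean (NormedField.toAbsoluteValue k) :=
          fun a b => IsUltrametricDist.norm_add_le_max a b
        rcases eq_or_lt_of_le (zero_le (a := ρ)) with h | h
        · simp [← h]
        · have h' : (0 : ℝ) < ρ := by exact_mod_cast h
          simpa using Polynomial.gaussNorm_mul hna h' (Polynomial.taylor c P)
            (Polynomial.taylor c Q)
      map_add_le_max' := fun P Q => by
        have hna : IsNonarchimedean (NormedField.toAbsoluteValue k) :=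
          fun a b => IsUltrametricDist.norm_add_le_max a b
        have := Polynomial.isNonarchimedean_gaussNorm _ hna ρ.2 (Polynomial.taylor c P)
          (Polynomial.taylor c Q)
        rw [← map_add] at this
        exact this }
  val_C a := by
    apply NNReal.eq
    change Polynomial.gaussNorm _ _ _ = _
    have := Polynomial.gaussNorm_C (v := NormedField.toAbsoluteValue k) (ρ : ℝ) a
    rwa [Polynomial.taylor_C]

/-- The Berkovich spectrum of an element `f` of a normed `k`-algebra `E` (only the completion of
`E` matters): the set of the points `x` of the affine line such that `f ⊗ 1 - 1 ⊗ T(x)` is not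
invertible in `E ⊗̂ ℋ(x)`. -/
def spectrum (k : Type*) [NormedField k] {E : Type*} [NormedRing E] [NormedAlgebra k E] (f : E) :
    Set (AffineLine k) :=
  {x | ¬ IsUnit (toCompletedTensor k
    (f ⊗ₜ[k] (1 : x.ResidueField) - (1 : E) ⊗ₜ[k] x.character Polynomial.X))}

end AffineLine

/-! ### The algebra of bounded operators -/

section Bounded

variable (k V : Type*) [NormedField k] [NormedAddCommGroup V] [NormedSpace k V]

/-- The `k`-algebra `L_k(V)` of the bounded `k`-linear endomorphisms of `V`. -/
def BoundedEnd : Subalgebra k (Module.End k V) where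
  carrier := {φ | ∃ C : ℝ, 0 ≤ C ∧ ∀ v, ‖φ v‖ ≤ C * ‖v‖}
  mul_mem' := by
    rintro φ ψ ⟨C, hC, h⟩ ⟨D, hD, h'⟩
    refine ⟨C * D, by positivity, fun v => (h _).trans ?_⟩
    rw [mul_assoc]
    exact mul_le_mul_of_nonneg_left (h' v) hC
  add_mem' := by
    rintro φ ψ ⟨C, hC, h⟩ ⟨D, hD, h'⟩
    refine ⟨C + D, by positivity, fun v => (norm_add_le _ _).trans ?_⟩
    rw [add_mul]
    exact add_le_add (h v) (h' v)
  algebraMap_mem' a := ⟨‖a‖, norm_nonneg a, fun v => by simp [norm_smul]⟩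

variable {k V}

/-- The operator norm `sup_{v ≠ 0} ‖φ v‖ / ‖v‖` (the term for `v = 0` is `0`). -/
def opNorm (φ : BoundedEnd k V) : ℝ := ⨆ v : V, ‖φ.1 v‖ / ‖v‖

lemma opNorm_nonneg (φ : BoundedEnd k V) : 0 ≤ opNorm φ :=
  Real.iSup_nonneg fun v => by positivity

lemma norm_apply_le (φ : BoundedEnd k V) (v : V) : ‖φ.1 v‖ ≤ opNorm φ * ‖v‖ := by
  rcases eq_or_ne v 0 with rfl | hv
  · simp
  obtain ⟨C, hC, h⟩ := φ.2
  have hv' : 0 < ‖v‖ := norm_pos_iff.2 hv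
  rw [← div_le_iff₀ hv']
  refine le_ciSup (f := fun v : V => ‖φ.1 v‖ / ‖v‖) ⟨C, ?_⟩ v
  rintro _ ⟨w, rfl⟩
  exact div_le_of_le_mul₀ (norm_nonneg _) hC (h w)

lemma opNorm_le (φ : BoundedEnd k V) {C : ℝ} (hC : 0 ≤ C) (h : ∀ v, ‖φ.1 v‖ ≤ C * ‖v‖) :
    opNorm φ ≤ C :=
  Real.iSup_le (fun v => div_le_of_le_mul₀ (norm_nonneg _) hC (h v)) hC

variable (k V)

/-- The operator norm as a submultiplicative norm on `L_k(V)`. -/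
def opRingNorm : RingNorm (BoundedEnd k V) where
  toFun := opNorm
  map_zero' := le_antisymm (opNorm_le _ le_rfl (by simp)) (opNorm_nonneg _)
  add_le' φ ψ := by
    refine opNorm_le _ (add_nonneg (opNorm_nonneg _) (opNorm_nonneg _)) fun v => ?_
    rw [add_mul]
    exact (norm_add_le _ _).trans (add_le_add (norm_apply_le φ v) (norm_apply_le ψ v))
  neg' φ := by simp [opNorm]
  mul_le' φ ψ := by
    refine opNorm_le _ (mul_nonneg (opNorm_nonneg _) (opNorm_nonneg _)) fun v => ?_
    rw [mul_assoc]
    exact (norm_apply_le φ _).trans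
      (mul_le_mul_of_nonneg_left (norm_apply_le ψ v) (opNorm_nonneg _))
  eq_zero_of_map_eq_zero' φ h := by
    ext v
    have := norm_apply_le φ v
    rw [show opNorm φ = 0 from h, zero_mul] at this
    simpa using this

instance : NormedRing (BoundedEnd k V) := (opRingNorm k V).toNormedRing

instance : NormedAlgebra k (BoundedEnd k V) where
  __ := (inferInstance : Algebra k (BoundedEnd k V))
  norm_smul_le a φ := by
    refine opNorm_le _ (mul_nonneg (norm_nonneg _) (opNorm_nonneg _)) fun v => ?_
    change ‖a • φ.1 v‖ ≤ _
    rw [norm_smul, mul_assoc]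
    exact mul_le_mul_of_nonneg_left (norm_apply_le φ v) (norm_nonneg _)

end Bounded

/-! ### Laurent series over a trivially valued field, and differential modules -/

/-- The absolute value of `k` is the trivial one. -/
class IsTriviallyNormed (k : Type*) [NormedField k] : Prop where
  norm_eq_one : ∀ a : k, a ≠ 0 → ‖a‖ = 1

instance (k : Type*) [NormedField k] [IsTriviallyNormed k] : IsUltrametricDist k :=
  IsUltrametricDist.isUltrametricDist_of_forall_norm_add_le_max_norm fun a b => by
    have h1 : ∀ c : k, ‖c‖ ≤ 1 := fun c => by
      rcases eq_or_ne c 0 with rfl | hc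
      · simp
      · exact (IsTriviallyNormed.norm_eq_one c hc).le
    rcases eq_or_ne a 0 with rfl | ha
    · simp
    · exact (h1 _).trans (by rw [IsTriviallyNormed.norm_eq_one a ha]; exact le_max_left _ _)

section Laurent

variable {k : Type*} [Field k]

/-- The derivation `S d/dS` of `k((S))`. -/
def eulerDeriv (f : k⸨X⸩) : k⸨X⸩ := HahnSeries.single (1 : ℤ) (1 : k) * LaurentSeries.derivative k f

lemma eulerDeriv_coeff (f : k⸨X⸩) (n : ℤ) : (eulerDeriv f).coeff n = n * f.coeff n := by
  have h : n = (n - 1) + 1 := by ring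
  conv_lhs => rw [h]
  rw [eulerDeriv, HahnSeries.coeff_single_mul_add]
  simp [LaurentSeries.derivative_apply]

/-- The `S`-adic absolute value on `k((S))` such that `|S| = r`. -/
def laurentAbs (r : Set.Ioo (0 : ℝ) 1) : AbsoluteValue k⸨X⸩ ℝ where
  toFun f := open Classical in if f = 0 then 0 else (r : ℝ) ^ f.order
  nonneg' f := by
    have := r.2.1
    split_ifs <;> positivity
  eq_zero' f := by
    have := r.2.1
    split_ifs with h
    · simp [h]
    · simp only [h, iff_false]; positivity
  map_mul' f g := by
    have := r.2.1
    by_cases hf : f = 0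
    · simp [hf]
    by_cases hg : g = 0
    · simp [hg]
    simp [hf, hg, HahnSeries.order_mul hf hg, zpow_add₀ this.ne']
  add_le' f g := by
    have h0 := r.2.1
    by_cases hfg : f + g = 0
    · simp only [hfg, if_true]; split_ifs <;> positivity
    by_cases hf : f = 0
    · have hg : g ≠ 0 := by rintro rfl; exact hfg (by simp [hf])
      simp only [hf, hg, if_true, if_false, zero_add, le_refl]
    by_cases hg : g = 0
    · simp only [hf, hg, if_true, if_false, add_zero, le_refl]
    simp only [hfg, hf, hg, if_false]
    have h := HahnSeries.min_order_le_order_add hfg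
    rcases min_le_iff.1 h with h | h
    · exact (zpow_le_zpow_right_of_le_one₀ h0 r.2.2.le h).trans
        (le_add_of_nonneg_right (by positivity))
    · exact (zpow_le_zpow_right_of_le_one₀ h0 r.2.2.le h).trans
        (le_add_of_nonneg_left (by positivity))

lemma laurentAbs_of_ne {r : Set.Ioo (0 : ℝ) 1} {f : k⸨X⸩} (hf : f ≠ 0) :
    laurentAbs r f = (r : ℝ) ^ f.order := by
  simp [laurentAbs, hf]

lemma laurentAbs_eulerDeriv_le (r : Set.Ioo (0 : ℝ) 1) (f : k⸨X⸩) :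
    laurentAbs r (eulerDeriv f) ≤ laurentAbs r f := by
  by_cases h : eulerDeriv f = 0
  · rw [h, map_zero]; exact (laurentAbs r).nonneg f
  have hf : f ≠ 0 := by
    rintro rfl
    exact h (by simp [eulerDeriv])
  rw [laurentAbs_of_ne h, laurentAbs_of_ne hf]
  refine zpow_le_zpow_right_of_le_one₀ r.2.1 r.2.2.le (HahnSeries.order_le_of_coeff_ne_zero ?_)
  have := mt HahnSeries.coeff_order_eq_zero.1 h
  rw [eulerDeriv_coeff] at this
  exact right_ne_zero_of_mul this

lemma laurentAbs_C (r : Set.Ioo (0 : ℝ) 1) {a : k} (ha : a ≠ 0) :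
    laurentAbs r (HahnSeries.C a : k⸨X⸩) = 1 := by
  rw [laurentAbs_of_ne (HahnSeries.C_ne_zero ha), HahnSeries.order_C, zpow_zero]

lemma C_smul {M : Type*} [AddCommGroup M] [Module k M] [Module k⸨X⸩ M] [IsScalarTower k k⸨X⸩ M]
    (a : k) (m : M) : (HahnSeries.C a : k⸨X⸩) • m = a • m := by
  have h : (HahnSeries.C a : k⸨X⸩) = a • (1 : k⸨X⸩) := by
    ext n
    simp [HahnSeries.C_apply, HahnSeries.coeff_single, HahnSeries.coeff_one]
  rw [h, smul_assoc, one_smul]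

end Laurent

section DiffModule

/-- A connection on a `k((S))`-vector space `M`, for the derivation `S d/dS`: a `k`-linear map
satisfying the Leibniz rule. For `M` of finite dimension, `(M, ∇)` is a differential module. -/
structure Connection (k M : Type*) [Field k] [AddCommGroup M] [Module k M] [Module k⸨X⸩ M] where
  /-- the underlying `k`-linear map -/
  toLinearMap : M →ₗ[k] M
  /-- the Leibniz rule -/
  leibniz : ∀ (f : k⸨X⸩) (m : M),
    toLinearMap (f • m) = eulerDeriv f • m + f • toLinearMap m

variable {k M ι : Type*} [Field k] [AddCommGroup M] [Module k⸨X⸩ M]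

/-- The matrix of a connection in a basis `e`: its `j`-th column is the vector `∇ (e j)`. -/
def Connection.matrix [Module k M] (D : Connection k M)
    (e : Module.Basis ι k⸨X⸩ M) : Matrix ι ι k⸨X⸩ :=
  fun i j => e.repr (D.toLinearMap (e j)) i

/-- The space `M`, to be equipped with the maximum norm of the coordinates in the basis `b`, for
the `S`-adic absolute value such that `|S| = r`. -/
def WithBasisNorm (_r : Set.Ioo (0 : ℝ) 1) (_b : Module.Basis ι k⸨X⸩ M) : Type _ := M

variable [Fintype ι]

/-- The norm `∑ f_i b_i ↦ max_i |f_i|`. -/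
def basisNorm (r : Set.Ioo (0 : ℝ) 1) (b : Module.Basis ι k⸨X⸩ M) : AddGroupNorm M where
  toFun m := ⨆ i, laurentAbs r (b.repr m i)
  map_zero' := by simp
  add_le' m n := by
    have h : ∀ m : M, BddAbove (Set.range fun i => laurentAbs r (b.repr m i)) :=
      fun m => (Set.finite_range _).bddAbove
    have h0 : ∀ m : M, 0 ≤ ⨆ i, laurentAbs r (b.repr m i) :=
      fun m => Real.iSup_nonneg fun i => (laurentAbs r).nonneg _
    refine Real.iSup_le (fun i => ?_) (add_nonneg (h0 m) (h0 n))
    rw [map_add, Finsupp.add_apply]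
    exact ((laurentAbs r).add_le _ _).trans (add_le_add (le_ciSup (h m) i) (le_ciSup (h n) i))
  neg' m := by simp
  eq_zero_of_map_eq_zero' m hm := by
    apply b.repr.injective
    ext i
    have h1 := le_ciSup (f := fun i => laurentAbs r (b.repr m i)) (Set.finite_range _).bddAbove i
    have h2 : laurentAbs r (b.repr m i) = 0 :=
      le_antisymm (h1.trans hm.le) ((laurentAbs r).nonneg _)
    rw [AbsoluteValue.eq_zero] at h2
    simp [h2]

lemma laurentAbs_repr_le (r : Set.Ioo (0 : ℝ) 1) (b : Module.Basis ι k⸨X⸩ M) (m : M) (i : ι) :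
    laurentAbs r (b.repr m i) ≤ basisNorm r b m :=
  le_ciSup (f := fun i => laurentAbs r (b.repr m i)) (Set.finite_range _).bddAbove i

lemma basisNorm_le (r : Set.Ioo (0 : ℝ) 1) (b : Module.Basis ι k⸨X⸩ M) (m : M) {C : ℝ}
    (hC : 0 ≤ C) (h : ∀ i, laurentAbs r (b.repr m i) ≤ C) : basisNorm r b m ≤ C :=
  Real.iSup_le h hC

instance (r : Set.Ioo (0 : ℝ) 1) (b : Module.Basis ι k⸨X⸩ M) :
    NormedAddCommGroup (WithBasisNorm r b) :=
  (basisNorm r b).toNormedAddCommGroup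

instance [Module k M] (r : Set.Ioo (0 : ℝ) 1) (b : Module.Basis ι k⸨X⸩ M) :
    Module k (WithBasisNorm r b) :=
  inferInstanceAs (Module k M)

end DiffModule

section NormedDiffModule

variable {k M ι : Type*} [NormedField k] [IsTriviallyNormed k] [AddCommGroup M] [Module k M]
  [Module k⸨X⸩ M] [IsScalarTower k k⸨X⸩ M] [Fintype ι]

lemma basisNorm_smul_le (r : Set.Ioo (0 : ℝ) 1) (b : Module.Basis ι k⸨X⸩ M) (a : k) (m : M) :
    basisNorm r b (a • m) ≤ ‖a‖ * basisNorm r b m := by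
  rcases eq_or_ne a 0 with rfl | ha
  · simp
  rw [IsTriviallyNormed.norm_eq_one a ha, one_mul]
  refine basisNorm_le r b _ (apply_nonneg _ _) fun i => ?_
  rw [← C_smul a m, map_smul, Finsupp.smul_apply, smul_eq_mul, map_mul, laurentAbs_C r ha,
    one_mul]
  exact laurentAbs_repr_le r b m i

instance (r : Set.Ioo (0 : ℝ) 1) (b : Module.Basis ι k⸨X⸩ M) :
    NormedSpace k (WithBasisNorm r b) where
  norm_smul_le a m := basisNorm_smul_le r b a m

/-- The connection `∇` as an element of the `k`-algebra `L_k(M)` of bounded operators, `M` being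
equipped with the maximum norm in the basis `b`. -/
def Connection.toBounded (D : Connection k M) (r : Set.Ioo (0 : ℝ) 1)
    (b : Module.Basis ι k⸨X⸩ M) : BoundedEnd k (WithBasisNorm r b) :=
  ⟨(show M →ₗ[k] M from D.toLinearMap), by
    refine ⟨1 + ∑ i, ∑ j, laurentAbs r (D.matrix b i j),
      add_nonneg zero_le_one (Finset.sum_nonneg fun i _ => Finset.sum_nonneg fun j _ =>
        (laurentAbs r).nonneg _), fun m => ?_⟩
    change basisNorm r b (D.toLinearMap m) ≤ _ * basisNorm r b m
    have hm0 : 0 ≤ basisNorm r b m := apply_nonneg _ _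
    refine basisNorm_le r b _ (mul_nonneg (add_nonneg zero_le_one (Finset.sum_nonneg fun i _ =>
      Finset.sum_nonneg fun j _ => (laurentAbs r).nonneg _)) hm0) fun i => ?_
    have e : b.repr (D.toLinearMap m) i =
        eulerDeriv (b.repr m i) + ∑ j, b.repr m j * D.matrix b i j := by
      classical
      conv_lhs => rw [← b.sum_repr m]
      simp only [map_sum, D.leibniz, map_add, map_smul, Finset.sum_add_distrib,
        Finsupp.add_apply, Finsupp.coe_finsetSum, Finset.sum_apply, Finsupp.smul_apply,
        smul_eq_mul, Module.Basis.repr_self, Finsupp.single_apply, mul_ite, mul_one, mul_zero,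
        Finset.sum_ite_eq', Finset.mem_univ, if_true]
      rfl
    rw [e, add_mul, one_mul]
    refine ((laurentAbs r).add_le _ _).trans (add_le_add
      ((laurentAbs_eulerDeriv_le r _).trans (laurentAbs_repr_le r b m i)) ?_)
    refine ((laurentAbs r).sum_le _ _).trans ?_
    calc ∑ j, laurentAbs r (b.repr m j * D.matrix b i j)
        ≤ ∑ j, laurentAbs r (D.matrix b i j) * basisNorm r b m := by
          refine Finset.sum_le_sum fun j _ => ?_
          rw [map_mul, mul_comm]
          exact mul_le_mul_of_nonneg_left (laurentAbs_repr_le r b m j) ((laurentAbs r).nonneg _)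
      _ = (∑ j, laurentAbs r (D.matrix b i j)) * basisNorm r b m := by rw [Finset.sum_mul]
      _ ≤ _ := by
          refine mul_le_mul_of_nonneg_right ?_ hm0
          exact Finset.single_le_sum (f := fun i => ∑ j, laurentAbs r (D.matrix b i j))
            (fun i _ => Finset.sum_nonneg fun j _ => (laurentAbs r).nonneg _)
            (Finset.mem_univ i)⟩

end NormedDiffModule

end BerkSpec

end

/-! In the basis `e`, the connection acts on the coefficient vector of `S ^ n` as the matrix `n +
G`. More generally, any family of polynomials `p n` acts coefficientwise through `p n (G)`
(`polyEnd`). Scalars of `k` have absolute value at most one, so all these operators are bounded by a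
single constant, whatever the family (`exists_norm_polyBounded_le`). The connection thus lies in a
uniformly bounded commutative algebra, where inverses may be chosen separately for each `n`.

Points outside the right-hand side. If `|T(x)| > 1`, a geometric series inverts `∇ - T(x)`
(`isUnit_sub_of_one_lt_norm`). If `0 < |T(x) - c| < 1` for some `c` in `k`, then `∇ - c` has a
bounded Drazin inverse: it splits into an invertible part, of which `T(x) - c` is a small
perturbation, and a nilpotent part, on which `T(x) - c` is a unit (`isUnit_sub_of_drazin`). If `T(x)
= c` is outside all `a_i + ℤ`, every `X + n - c` is prime to the characteristic polynomial of `G`,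
and the Bézout inverses assemble. The only other point has `|T(x) - c| = 1` for all `c`, and it is
`x_{0,1}`.

Points of the right-hand side. There `ℋ(x)` is trivially valued. An inverse is approximated by a
finite sum of tensors, whose second factors span a finite-dimensional `V` in `ℋ(x)`; testing on
eigenvectors forces `1` into `(c - T(x)) V` for every eigenvalue `c` of `∇`
(`exists_finite_of_isUnit`). The eigenvalues include all `a + n`. This is absurd when `T(x)` is one
of them; at `x_{0,1}` it puts the infinitely many independent elements `1 / (T(x) - a - n)` in `V`.
-/

noncomputable section

namespace BerkSpec

/-! ### Invertibility in the completed tensor product -/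

section CompletedTensor

variable (k A B : Type*) [NormedField k] [NormedRing A] [NormedAlgebra k A]
  [NormedField B] [NormedAlgebra k B]

/-- The canonical map to the completed tensor product, as a ring homomorphism. -/
def completedTensorHom : A ⊗[k] B →+* CompletedTensor k A B :=
  (UniformSpace.Completion.coeRingHom (α := NormedTensor k A B) :)

variable {A B}

lemma completedTensorHom_apply (t : A ⊗[k] B) :
    completedTensorHom k A B t = toCompletedTensor k t := rfl

lemma norm_completedTensorHom (t : A ⊗[k] B) :
    ‖completedTensorHom k A B t‖ = tensorNormFun k A B t :=
  UniformSpace.Completion.norm_coe (E := NormedTensor k A B) _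

lemma norm_completedTensorHom_tmul_le (a : A) (b : B) :
    ‖completedTensorHom k A B (a ⊗ₜ b)‖ ≤ ‖a‖ * ‖b‖ := by
  rw [norm_completedTensorHom]
  simpa using tensorNormFun_le k (ι := Fin 1) (fun _ => a) (fun _ => b)
    (C := ‖a‖ * ‖b‖) (by positivity) (by simp)

/-- The algebraic tensors are dense, so the inverse can be approximated by a finite sum; this is
what makes finite-dimensional arguments available. -/
lemma exists_approx_left_inverse {F : A ⊗[k] B} (hF : IsUnit (toCompletedTensor k F)) :
    ∃ u : A ⊗[k] B, tensorNormFun k A B (u * F - 1) < 1 := by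
  obtain ⟨U, hU⟩ := hF
  rw [← completedTensorHom_apply] at hU
  have hopen : IsOpen {V : CompletedTensor k A B | ‖V * completedTensorHom k A B F - 1‖ < 1} :=
    isOpen_lt (by fun_prop) continuous_const
  obtain ⟨V, hV, hVu⟩ := (UniformSpace.Completion.denseRange_coe
    (α := NormedTensor k A B)).inter_open_nonempty _ hopen ⟨U.inv, by simp [← hU]⟩
  obtain ⟨u, rfl⟩ : ∃ u : A ⊗[k] B, completedTensorHom k A B u = V := hVu
  refine ⟨u, ?_⟩
  rw [← norm_completedTensorHom, map_sub, map_mul, map_one]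
  exact hV

variable {Q : Type*} [CommRing Q] [Algebra k Q] (Ψ : Q →ₐ[k] A) {C : ℝ} (hC : ∀ q, ‖Ψ q‖ ≤ C)

variable (B) in
/-- The homomorphism `Q ⊗ B → A ⊗̂ B` induced by `Q → A`. -/
def completedMap : Q ⊗[k] B →+* CompletedTensor k A B :=
  (completedTensorHom k A B).comp (Algebra.TensorProduct.map Ψ (AlgHom.id k B)).toRingHom

lemma completedMap_tmul (q : Q) (h : B) :
    completedMap k B Ψ (q ⊗ₜ h) = completedTensorHom k A B (Ψ q ⊗ₜ h) := by
  simp [completedMap]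

/-- The target need not be commutative, but the two images commute since the source is.
Invertibility can therefore be settled by divisibility in `Q ⊗ B`. -/
lemma isUnit_of_dvd_map {R S : Type*} [CommRing R] [Ring S] (φ : R →+* S) {x y : R}
    (hxy : x ∣ y) (hy : IsUnit (φ y)) : IsUnit (φ x) := by
  obtain ⟨z, rfl⟩ := hxy
  rw [map_mul] at hy
  exact ((Commute.isUnit_mul_iff ((Commute.all x z).map φ)).1 hy).1

-- Since `C` bounds `Ψ` on all of `Q`, powers of `q` stay bounded while `h ^ j` tends to zero. One
-- power suffices; `j = 1` may fail because `C` can exceed one.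
include hC in
lemma exists_isUnit_one_sub (q s : Q) {h : B} (hh : ‖h‖ < 1) :
    ∃ j, 0 < j ∧ IsUnit (completedMap k B Ψ (1 - (q ^ j * s) ⊗ₜ (h ^ j))) := by
  have hlim : Filter.Tendsto (fun j : ℕ => C * ‖h‖ ^ j) Filter.atTop (nhds (C * 0)) :=
    (tendsto_pow_atTop_nhds_zero_of_lt_one (norm_nonneg _) hh).const_mul C
  rw [mul_zero] at hlim
  obtain ⟨j, hj, hj0⟩ := ((hlim.eventually (gt_mem_nhds one_pos)).and
    (Filter.eventually_gt_atTop 0)).exists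
  refine ⟨j, hj0, ?_⟩
  rw [map_sub, map_one, completedMap_tmul]
  refine isUnit_one_sub_of_norm_lt_one ((norm_completedTensorHom_tmul_le k _ _).trans_lt ?_)
  rw [norm_pow]
  exact (mul_le_mul_of_nonneg_right (hC _) (by positivity)).trans_lt hj

include hC in
lemma isUnit_sub_of_one_lt_norm (f : Q) {t : B} (ht : 1 < ‖t‖) :
    IsUnit (completedMap k B Ψ (f ⊗ₜ 1 - 1 ⊗ₜ t)) := by
  have ht0 : t ≠ 0 := by rintro rfl; simp at ht; linarith
  obtain ⟨j, -, hj⟩ := exists_isUnit_one_sub k Ψ hC f 1 (h := t⁻¹)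
    (by rw [norm_inv]; exact inv_lt_one_of_one_lt₀ ht)
  refine isUnit_of_dvd_map _ ?_ hj
  have h1 : (f ⊗ₜ[k] t⁻¹ : Q ⊗[k] B) = (f ⊗ₜ 1) * (1 ⊗ₜ t⁻¹) := by simp
  have h2 : (1 ⊗ₜ[k] t : Q ⊗[k] B) * (1 ⊗ₜ t⁻¹) = 1 := by
    simp [ht0, Algebra.TensorProduct.one_def]
  have h3 : (1 : Q ⊗[k] B) - (f ^ j * 1) ⊗ₜ (t⁻¹ ^ j) = 1 ^ j - (f ⊗ₜ[k] t⁻¹) ^ j := by simp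
  rw [h3]
  -- `1 - f ⊗ t⁻¹` divides `1 - (f ⊗ t⁻¹) ^ j`, and it equals `f ⊗ 1 - 1 ⊗ t` up to the unit `-(1 ⊗
  -- t⁻¹)`.
  refine Dvd.dvd.trans ?_ (sub_dvd_pow_sub_pow _ _ _)
  refine ⟨- (1 ⊗ₜ t⁻¹), ?_⟩
  rw [h1]
  linear_combination -h2

-- `f * R` acts as an idempotent. On its image `R` inverts `f` and `1 - t R` is inverted by a
-- geometric series; on the complement `f ^ d = 0`, and `f - t` is inverted by a finite sum since
-- `t` is a unit.
include hC in
lemma isUnit_sub_of_drazin {f R : Q} {d : ℕ} (hd : Ψ (f ^ d * (1 - f * R)) = 0)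
    (hR : Ψ (f * R * (1 - f * R)) = 0) {t : B} (ht0 : t ≠ 0) (ht : ‖t‖ < 1) :
    IsUnit (completedMap k B Ψ (f ⊗ₜ 1 - 1 ⊗ₜ t)) := by
  obtain ⟨j, -, hj⟩ := exists_isUnit_one_sub k Ψ hC R (f * R) ht
  set F : Q ⊗[k] B := f ⊗ₜ 1 with hF
  set R' : Q ⊗[k] B := R ⊗ₜ 1 with hR'
  set T : Q ⊗[k] B := 1 ⊗ₜ t with hT
  set T' : Q ⊗[k] B := 1 ⊗ₜ t⁻¹ with hT'
  have hTT : T * T' = 1 := by simp [hT, hT', ht0, Algebra.TensorProduct.one_def]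
  have hTd : T ^ d * T' ^ d = 1 := by rw [← mul_pow, hTT, one_pow]
  have e1 : F ^ d * (1 - F * R') = (f ^ d * (1 - f * R)) ⊗ₜ 1 := by
    simp [hF, hR', Algebra.TensorProduct.one_def, TensorProduct.sub_tmul, mul_sub]
  have e2 : F * R' * (1 - F * R') = (f * R * (1 - f * R)) ⊗ₜ 1 := by
    simp [hF, hR', Algebra.TensorProduct.one_def, TensorProduct.sub_tmul, mul_sub]
  have e3 : (1 : Q ⊗[k] B) - (R ^ j * (f * R)) ⊗ₜ (t ^ j) = 1 - (T * R') ^ j * (F * R') := by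
    simp [hF, hR', hT]
  have k1 : completedMap k B Ψ (F ^ d * (1 - F * R')) = 0 := by
    rw [e1, completedMap_tmul, hd, TensorProduct.zero_tmul, map_zero]
  have k2 : completedMap k B Ψ (F * R' * (1 - F * R')) = 0 := by
    rw [e2, completedMap_tmul, hR, TensorProduct.zero_tmul, map_zero]
  rw [e3] at hj
  obtain ⟨Y, hY⟩ := sub_dvd_pow_sub_pow F T d
  have hs := mul_neg_geom_sum (T * R') j
  set s := ∑ i ∈ Finset.range j, (T * R') ^ i
  -- The cofactor glues the truncated inverses of the two parts. Their product with `F - T` is `1 -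
  -- (T * R') ^ j * (F * R')` up to multiples of the two Drazin relations, which `completedMap`
  -- kills.
  refine isUnit_of_dvd_map (y := 1 - (T * R') ^ j * (F * R')
    - F * R' * (1 - F * R') * s - T' ^ d * (F ^ d * (1 - F * R'))) _
    ⟨R' * (F * R') * s - T' ^ d * Y * (1 - F * R'), ?_⟩ ?_
  · linear_combination (-(F * R')) * hs - T' ^ d * (1 - F * R') * hY - (1 - F * R') * hTd
  · rw [map_sub, map_sub, map_mul _ (_ * _) s, map_mul _ (T' ^ d), k1, k2]
    simpa using hj

lemma isUnit_tmul_one {f : Q} (hf : IsUnit (Ψ f)) :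
    IsUnit (completedMap k B Ψ (f ⊗ₜ 1 - 1 ⊗ₜ 0)) := by
  rw [TensorProduct.tmul_zero, sub_zero, completedMap_tmul]
  exact (hf.map (Algebra.TensorProduct.includeLeft : A →ₐ[k] A ⊗[k] B)).map
    (completedTensorHom k A B)

end CompletedTensor

/-! ### Drazin inverses of linear polynomials modulo `p` -/

section Drazin

variable {K : Type*} [Field K]

/-- A polynomial Drazin inverse of `X + c` modulo `p`. -/
lemma exists_drazin_inverse {p : K[X]} (hp : p ≠ 0) {d : ℕ} (hd : p.natDegree ≤ d) (c : K) :
    ∃ R : K[X], p ∣ (Polynomial.X + Polynomial.C c) ^ d *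
        (1 - (Polynomial.X + Polynomial.C c) * R) ∧
      p ∣ (Polynomial.X + Polynomial.C c) * R * (1 - (Polynomial.X + Polynomial.C c) * R) := by
  classical
  obtain ⟨q, hq, hnd⟩ := Polynomial.exists_eq_pow_rootMultiplicity_mul_and_not_dvd p hp (-c)
  have hm : p.rootMultiplicity (-c) ≤ d := by
    refine le_trans ?_ hd
    rw [← Polynomial.count_roots]
    exact (Multiset.count_le_card _ _).trans (Polynomial.card_roots' p)
  set m := p.rootMultiplicity (-c)
  have hX : (Polynomial.X - Polynomial.C (-c) : K[X]) = Polynomial.X + Polynomial.C c := by simp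
  have hirr : Irreducible (Polynomial.X - Polynomial.C (-c) : K[X]) :=
    Polynomial.irreducible_X_sub_C _
  -- The exponent `m + 1` makes `f * R = a * f ^ (m + 1)` for `R = a * f ^ m`, including when `m =
  -- 0`. Then `1 - f * R = b * q`, and both relations follow from `p = f ^ m * q`.
  have hcop : IsCoprime ((Polynomial.X - Polynomial.C (-c)) ^ (m + 1)) q :=
    ((hirr.coprime_iff_not_dvd).2 hnd).pow_left
  rw [hX] at hq hcop
  obtain ⟨a, b, hab⟩ := hcop
  set f : K[X] := Polynomial.X + Polynomial.C c
  obtain ⟨l, rfl⟩ := Nat.exists_eq_add_of_le hm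
  refine ⟨a * f ^ m, ⟨b * f ^ l, ?_⟩, ⟨a * f * b, ?_⟩⟩
  · rw [hq]
    linear_combination (-(f ^ (m + l))) * hab
  · rw [hq]
    linear_combination (-(f * (a * f ^ m))) * hab

end Drazin

/-! ### Operators acting coefficientwise on `M` -/

section Scale

variable {k : Type*} [Field k] {M ι : Type*} [AddCommGroup M] [Module k M] [Module k⸨X⸩ M]
  [IsScalarTower k k⸨X⸩ M] [Fintype ι] [DecidableEq ι]

/-- Multiplication of the coefficient of `S ^ n` by `s n`. -/
def scaleCoeff (s : ℤ → k) (f : k⸨X⸩) : k⸨X⸩ where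
  coeff n := s n * f.coeff n
  isPWO_support' := f.isPWO_support.mono fun n hn => by
    simp only [Function.mem_support] at hn
    exact right_ne_zero_of_mul hn

@[simp] lemma scaleCoeff_coeff (s : ℤ → k) (f : k⸨X⸩) (n : ℤ) :
    (scaleCoeff s f).coeff n = s n * f.coeff n := rfl

lemma laurentAbs_le_of_support {r : Set.Ioo (0 : ℝ) 1} {f g : k⸨X⸩}
    (h : ∀ n, f.coeff n = 0 → g.coeff n = 0) : laurentAbs r g ≤ laurentAbs r f := by
  by_cases hg : g = 0
  · rw [hg, map_zero]; exact (laurentAbs r).nonneg f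
  have hc := mt (h _) (mt HahnSeries.coeff_order_eq_zero.1 hg)
  have hf : f ≠ 0 := by rintro rfl; exact hc rfl
  rw [laurentAbs_of_ne hg, laurentAbs_of_ne hf]
  exact zpow_le_zpow_right_of_le_one₀ r.2.1 r.2.2.le (HahnSeries.order_le_of_coeff_ne_zero hc)

lemma laurentAbs_add_le_max (r : Set.Ioo (0 : ℝ) 1) (f g : k⸨X⸩) :
    laurentAbs r (f + g) ≤ max (laurentAbs r f) (laurentAbs r g) := by
  by_cases hfg : f + g = 0
  · rw [hfg, map_zero]; exact le_max_of_le_left ((laurentAbs r).nonneg f)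
  have hc := mt HahnSeries.coeff_order_eq_zero.1 hfg
  rw [HahnSeries.coeff_add] at hc
  have key : ∀ h : k⸨X⸩, h.coeff (f + g).order ≠ 0 → laurentAbs r (f + g) ≤ laurentAbs r h := by
    intro h hh
    have h0 : h ≠ 0 := by rintro rfl; exact hh rfl
    rw [laurentAbs_of_ne hfg, laurentAbs_of_ne h0]
    exact zpow_le_zpow_right_of_le_one₀ r.2.1 r.2.2.le (HahnSeries.order_le_of_coeff_ne_zero hh)
  by_cases hf : f.coeff (f + g).order = 0
  · exact le_max_of_le_right (key g (by simpa [hf] using hc))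
  · exact le_max_of_le_left (key f hf)

lemma laurentAbs_sum_le {α : Type*} (r : Set.Ioo (0 : ℝ) 1) (s : Finset α) (f : α → k⸨X⸩) {C : ℝ}
    (hC : 0 ≤ C) (h : ∀ i ∈ s, laurentAbs r (f i) ≤ C) : laurentAbs r (∑ i ∈ s, f i) ≤ C := by
  classical
  induction s using Finset.induction_on with
  | empty => simpa
  | insert a s ha ih =>
    rw [Finset.sum_insert ha]
    exact (laurentAbs_add_le_max r _ _).trans (max_le (h a (by simp))
      (ih fun i hi => h i (by simp [hi])))

lemma sum_coeff_laurent {α : Type*} (s : Finset α) (f : α → k⸨X⸩) (n : ℤ) :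
    (∑ i ∈ s, f i).coeff n = ∑ i ∈ s, (f i).coeff n :=
  map_sum (HahnSeries.coeff.addMonoidHom n : k⸨X⸩ →+ k) f s

/-- The vector of the coefficients of `S ^ n` of the coordinates of `m`. -/
def coeffVec (e : Module.Basis ι k⸨X⸩ M) (n : ℤ) (m : M) : ι → k :=
  fun i => (e.repr m i).coeff n

omit [Module k M] [IsScalarTower k k⸨X⸩ M] [DecidableEq ι] [Fintype ι] in
lemma ext_coeffVec (e : Module.Basis ι k⸨X⸩ M) {m m' : M}
    (h : ∀ n, coeffVec e n m = coeffVec e n m') : m = m' := by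
  apply e.repr.injective
  ext i n
  exact congr_fun (h n) i

omit [Module k M] [IsScalarTower k k⸨X⸩ M] [DecidableEq ι] [Fintype ι] in
lemma coeffVec_add (e : Module.Basis ι k⸨X⸩ M) (n : ℤ) (m m' : M) :
    coeffVec e n (m + m') = coeffVec e n m + coeffVec e n m' := by
  ext i; simp [coeffVec]

omit [DecidableEq ι] [Fintype ι] in
lemma coeffVec_smul (e : Module.Basis ι k⸨X⸩ M) (n : ℤ) (a : k) (m : M) :
    coeffVec e n (a • m) = a • coeffVec e n m := by
  ext i
  rw [coeffVec, ← C_smul a m]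
  simp [coeffVec]

/-- The vector whose coefficients are obtained by applying the matrices `A n`. -/
def matrixOp (e : Module.Basis ι k⸨X⸩ M) (A : ℤ → Matrix ι ι k) (m : M) : M :=
  e.equivFun.symm fun i => ∑ j, scaleCoeff (fun n => A n i j) (e.repr m j)

omit [Module k M] [IsScalarTower k k⸨X⸩ M] [DecidableEq ι] in
lemma coeffVec_matrixOp (e : Module.Basis ι k⸨X⸩ M) (A : ℤ → Matrix ι ι k) (n : ℤ) (m : M) :
    coeffVec e n (matrixOp e A m) = (A n).mulVec (coeffVec e n m) := by
  ext i
  rw [coeffVec, matrixOp, ← Module.Basis.equivFun_apply, LinearEquiv.apply_symm_apply,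
    sum_coeff_laurent]
  rfl

/-- The `k`-linear endomorphism of `M` which acts on the coefficients of `S ^ n` by `p n (G)`. -/
def polyEnd (e : Module.Basis ι k⸨X⸩ M) (G : Matrix ι ι k) : (ℤ → k[X]) →ₐ[k] Module.End k M :=
  AlgHom.ofLinearMap
    { toFun := fun p =>
        { toFun := matrixOp e fun n => Polynomial.aeval G (p n)
          map_add' := fun m m' => ext_coeffVec e fun n => by
            simp only [coeffVec_add, coeffVec_matrixOp, Matrix.mulVec_add]
          map_smul' := fun a m => ext_coeffVec e fun n => by
            simp only [coeffVec_smul, coeffVec_matrixOp, Matrix.mulVec_smul, RingHom.id_apply] }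
      map_add' := fun p q => LinearMap.ext fun m => ext_coeffVec e fun n => by
        simp [coeffVec_add, coeffVec_matrixOp, Matrix.add_mulVec]
      map_smul' := fun a p => LinearMap.ext fun m => ext_coeffVec e fun n => by
        simp [coeffVec_smul, coeffVec_matrixOp, Matrix.smul_mulVec] }
    (LinearMap.ext fun m => ext_coeffVec e fun n => by simp [coeffVec_matrixOp])
    (fun p q => LinearMap.ext fun m => ext_coeffVec e fun n => by simp [coeffVec_matrixOp])

lemma coeffVec_polyEnd (e : Module.Basis ι k⸨X⸩ M) (G : Matrix ι ι k) (p : ℤ → k[X]) (n : ℤ)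
    (m : M) : coeffVec e n (polyEnd e G p m) =
      (Polynomial.aeval G (p n)).mulVec (coeffVec e n m) :=
  coeffVec_matrixOp e _ n m

/-- Cayley–Hamilton, applied for each `n`. Congruences modulo the characteristic polynomial become
identities between operators. -/
lemma polyEnd_eq_zero (e : Module.Basis ι k⸨X⸩ M) (G : Matrix ι ι k) {p : ℤ → k[X]}
    (h : ∀ n, G.charpoly ∣ p n) : polyEnd e G p = 0 :=
  LinearMap.ext fun m => ext_coeffVec e fun n => by
    obtain ⟨q, hq⟩ := h n
    rw [coeffVec_polyEnd, hq, map_mul, Matrix.aeval_self_charpoly, zero_mul, Matrix.zero_mulVec]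
    ext i; simp [coeffVec]

omit [IsScalarTower k k⸨X⸩ M] in
lemma Connection.coeffVec_apply (D : Connection k M) (e : Module.Basis ι k⸨X⸩ M)
    (G : Matrix ι ι k) (hG : D.matrix e = G.map HahnSeries.C) (n : ℤ) (m : M) :
    coeffVec e n (D.toLinearMap m) = (n : k) • coeffVec e n m + G.mulVec (coeffVec e n m) := by
  have h : ∀ i, e.repr (D.toLinearMap m) i =
      eulerDeriv (e.repr m i) + ∑ j, e.repr m j * HahnSeries.C (G i j) := by
    intro i
    have hG' : ∀ j, e.repr (D.toLinearMap (e j)) i = HahnSeries.C (G i j) :=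
      fun j => congr_fun (congr_fun hG i) j
    conv_lhs => rw [← e.sum_repr m]
    simp only [map_sum, D.leibniz, map_add, map_smul, Finset.sum_add_distrib,
      Finsupp.add_apply, Finsupp.coe_finsetSum, Finset.sum_apply, Finsupp.smul_apply,
      smul_eq_mul, Module.Basis.repr_self, Finsupp.single_apply, mul_ite, mul_one, mul_zero,
      Finset.sum_ite_eq', Finset.mem_univ, if_true, hG']
  ext i
  rw [coeffVec, h, HahnSeries.coeff_add, eulerDeriv_coeff, sum_coeff_laurent]
  simp only [mul_comm _ (HahnSeries.C _), HahnSeries.C_mul_eq_smul]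
  rfl

lemma polyEnd_eq_connection (D : Connection k M) (e : Module.Basis ι k⸨X⸩ M)
    (G : Matrix ι ι k) (hG : D.matrix e = G.map HahnSeries.C) :
    polyEnd e G (fun n => Polynomial.X + Polynomial.C (n : k)) = D.toLinearMap :=
  LinearMap.ext fun m => ext_coeffVec e fun n => by
    rw [coeffVec_polyEnd, D.coeffVec_apply e G hG]
    simp [Matrix.add_mulVec, add_comm]

/-- An eigenvector `v` of `G` for `a`, multiplied by `S ^ n`, has its eigenvalue shifted by `n`. -/
lemma Connection.exists_eigenvector (D : Connection k M) (e : Module.Basis ι k⸨X⸩ M)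
    (G : Matrix ι ι k) (hG : D.matrix e = G.map HahnSeries.C) {a : k}
    (ha : Module.End.HasEigenvalue (Matrix.toLin' G) a) (n : ℤ) :
    ∃ m : M, m ≠ 0 ∧ D.toLinearMap m = (a + n) • m := by
  obtain ⟨v, hv⟩ := ha.exists_hasEigenvector
  have hGv : G.mulVec v = a • v := by simpa using hv.apply_eq_smul
  set m : M := e.equivFun.symm fun i => HahnSeries.single n (v i)
  have hm : ∀ l, coeffVec e l m = if l = n then v else 0 := by
    intro l
    ext i
    rw [coeffVec, ← Module.Basis.equivFun_apply, LinearEquiv.apply_symm_apply,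
      HahnSeries.coeff_single]
    split_ifs <;> rfl
  refine ⟨m, ?_, ext_coeffVec e fun l => ?_⟩
  · intro h0
    refine hv.2 ?_
    have := hm n
    rw [h0, if_pos rfl] at this
    rw [← this]
    ext i; simp [coeffVec]
  · rw [D.coeffVec_apply e G hG, coeffVec_smul, hm]
    split_ifs with h
    · subst h
      rw [hGv, add_smul, add_comm]
    · simp

end Scale

/-! ### Comparison of norms and uniform bounds -/

section Norms

variable {k : Type*} [Field k] {M ι κ : Type*} [AddCommGroup M] [Module k⸨X⸩ M]
  [Fintype ι] [Fintype κ]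

lemma exists_basisNorm_le (r : Set.Ioo (0 : ℝ) 1) (b : Module.Basis κ k⸨X⸩ M)
    (e : Module.Basis ι k⸨X⸩ M) : ∃ C, 0 ≤ C ∧ ∀ m, basisNorm r b m ≤ C * basisNorm r e m := by
  have h0 : 0 ≤ ∑ i, basisNorm r b (e i) := Finset.sum_nonneg fun i _ => apply_nonneg _ _
  refine ⟨_, h0, fun m => ?_⟩
  have hm : 0 ≤ basisNorm r e m := apply_nonneg _ _
  refine basisNorm_le r b m (mul_nonneg h0 hm) fun j => ?_
  have hj : b.repr m j = ∑ i, e.repr m i * b.repr (e i) j := by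
    conv_lhs => rw [← e.sum_repr m]
    simp only [map_sum, map_smul, Finsupp.coe_finsetSum, Finset.sum_apply, Finsupp.smul_apply,
      smul_eq_mul]
  rw [hj]
  refine laurentAbs_sum_le r _ _ (mul_nonneg h0 hm) fun i _ => ?_
  rw [map_mul, mul_comm]
  refine mul_le_mul ?_ (laurentAbs_repr_le r e m i) ((laurentAbs r).nonneg _) h0
  exact (laurentAbs_repr_le r b (e i) j).trans (Finset.single_le_sum
    (f := fun i => basisNorm r b (e i)) (fun i _ => apply_nonneg _ _) (Finset.mem_univ i))

instance isUltrametricDist_withBasisNorm (r : Set.Ioo (0 : ℝ) 1) (b : Module.Basis κ k⸨X⸩ M) :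
    IsUltrametricDist (WithBasisNorm r b) :=
  IsUltrametricDist.isUltrametricDist_of_forall_norm_add_le_max_norm fun (m m' : M) => by
    change basisNorm r b (m + m') ≤ max (basisNorm r b m) (basisNorm r b m')
    refine basisNorm_le r b _ (le_max_of_le_left (apply_nonneg _ _)) fun i => ?_
    rw [map_add, Finsupp.add_apply]
    exact (laurentAbs_add_le_max r _ _).trans
      (max_le_max (laurentAbs_repr_le r b _ i) (laurentAbs_repr_le r b _ i))

variable [DecidableEq ι] [Module k M] [IsScalarTower k k⸨X⸩ M]

/-- The norm sees only orders of vanishing, which coefficientwise scaling and finite sums cannot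
lower. The bound is therefore independent of `p`. -/
lemma basisNorm_polyEnd_le (r : Set.Ioo (0 : ℝ) 1) (e : Module.Basis ι k⸨X⸩ M)
    (G : Matrix ι ι k) (p : ℤ → k[X]) (m : M) :
    basisNorm r e (polyEnd e G p m) ≤ basisNorm r e m := by
  refine basisNorm_le r e _ (apply_nonneg _ _) fun i => ?_
  change laurentAbs r (e.repr (matrixOp e _ m) i) ≤ _
  rw [matrixOp, ← Module.Basis.equivFun_apply, LinearEquiv.apply_symm_apply]
  refine laurentAbs_sum_le r _ _ (apply_nonneg _ _) fun j _ => ?_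
  refine le_trans (laurentAbs_le_of_support fun n hn => ?_) (laurentAbs_repr_le r e m j)
  simp [hn]

end Norms

/-! ### The coefficientwise operators as bounded operators -/

section Bounded

variable {k : Type*} [NormedField k] [IsTriviallyNormed k] {M ι κ : Type*} [AddCommGroup M]
  [Module k M] [Module k⸨X⸩ M] [IsScalarTower k k⸨X⸩ M] [Fintype ι] [DecidableEq ι] [Fintype κ]

omit [IsTriviallyNormed k] in
lemma exists_bound_polyEnd (r : Set.Ioo (0 : ℝ) 1) (b : Module.Basis κ k⸨X⸩ M)
    (e : Module.Basis ι k⸨X⸩ M) (G : Matrix ι ι k) : ∃ C, 0 ≤ C ∧ ∀ p m,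
      basisNorm r b (polyEnd e G p m) ≤ C * basisNorm r b m := by
  obtain ⟨C, hC, h⟩ := exists_basisNorm_le r b e
  obtain ⟨C', hC', h'⟩ := exists_basisNorm_le r e b
  refine ⟨C * C', mul_nonneg hC hC', fun p m => (h _).trans ?_⟩
  rw [mul_assoc]
  exact mul_le_mul_of_nonneg_left ((basisNorm_polyEnd_le r e G p m).trans (h' m)) hC

/-- `polyEnd` with values in the algebra of bounded operators. -/
def polyBounded (r : Set.Ioo (0 : ℝ) 1) (b : Module.Basis κ k⸨X⸩ M)
    (e : Module.Basis ι k⸨X⸩ M) (G : Matrix ι ι k) :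
    (ℤ → k[X]) →ₐ[k] BoundedEnd k (WithBasisNorm r b) :=
  AlgHom.codRestrict (polyEnd e G : (ℤ → k[X]) →ₐ[k] Module.End k M) _
    fun p => by
      obtain ⟨C, hC, h⟩ := exists_bound_polyEnd r b e G
      exact ⟨C, hC, h p⟩

lemma exists_norm_polyBounded_le (r : Set.Ioo (0 : ℝ) 1) (b : Module.Basis κ k⸨X⸩ M)
    (e : Module.Basis ι k⸨X⸩ M) (G : Matrix ι ι k) : ∃ C, ∀ p, ‖polyBounded r b e G p‖ ≤ C := by
  obtain ⟨C, hC, h⟩ := exists_bound_polyEnd r b e G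
  exact ⟨C, fun p => opNorm_le _ hC (h p)⟩

lemma polyBounded_eq_zero (r : Set.Ioo (0 : ℝ) 1) (b : Module.Basis κ k⸨X⸩ M)
    (e : Module.Basis ι k⸨X⸩ M) (G : Matrix ι ι k) {p : ℤ → k[X]}
    (h : ∀ n, G.charpoly ∣ p n) : polyBounded r b e G p = 0 :=
  Subtype.ext (polyEnd_eq_zero e G h)

lemma polyBounded_eq_connection (r : Set.Ioo (0 : ℝ) 1) (b : Module.Basis κ k⸨X⸩ M)
    (D : Connection k M) (e : Module.Basis ι k⸨X⸩ M)
    (G : Matrix ι ι k) (hG : D.matrix e = G.map HahnSeries.C) :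
    polyBounded r b e G (fun n => Polynomial.X + Polynomial.C (n : k)) = D.toBounded r b :=
  Subtype.ext (polyEnd_eq_connection D e G hG)

end Bounded

/-! ### An obstruction to invertibility from eigenvectors -/

section NotUnit

variable {k W H : Type*} [NormedField k] [IsTriviallyNormed k] [NormedAddCommGroup W]
  [NormedSpace k W] [IsUltrametricDist W] [NormedField H] [NormedAlgebra k H]

/-- `V` is spanned by the second factors of one approximate left inverse, so it does not depend on
the eigenvalue `c`; infinitely many eigenvalues can be tested against it. -/
lemma exists_finite_of_isUnit (hH : ∀ g : H, g ≠ 0 → ‖g‖ = 1) (f : BoundedEnd k W) (T : H)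
    (hf : IsUnit (toCompletedTensor k (f ⊗ₜ[k] (1 : H) - (1 : BoundedEnd k W) ⊗ₜ[k] T))) :
    ∃ V : Submodule k H, V.FG ∧ ∀ (c : k) (m : W), m ≠ 0 → f.1 m = c • m →
      ∃ v ∈ V, (algebraMap k H c - T) * v = 1 := by
  classical
  obtain ⟨u, hu⟩ := exists_approx_left_inverse k hf
  obtain ⟨C, hC, hC1⟩ := exists_between hu
  obtain ⟨N, ψ, g, hg, hle⟩ := exists_rep_lt k _ hC
  have hC0 : 0 ≤ C := (tensorNormFun_nonneg k _).trans hC.le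
  obtain ⟨s, hs⟩ := TensorProduct.exists_finset u
  refine ⟨Submodule.span k (s.image Prod.snd : Finset H), ⟨_, rfl⟩, fun c m hm hcm => ?_⟩
  set V := Submodule.span k ((s.image Prod.snd : Finset H) : Set H)
  by_contra hcon
  have h1 : (1 : H) ∉ V.map (LinearMap.mulLeft k (algebraMap k H c - T)) := by
    rintro ⟨v, hv, hv1⟩
    exact hcon ⟨v, hv, hv1⟩
  -- A functional killing `(c - T) V` but not `1`. Paired with evaluation at `m`, it kills `u * F`
  -- and sends `1` to a vector of norm `‖m‖`, whereas `u * F - 1` has tensor norm less than one.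
  obtain ⟨l, hl1, hl⟩ := Submodule.exists_le_ker_of_notMem h1
  have hlV : ∀ v ∈ V, l (T * v) = c * l v := by
    intro v hv
    have : l ((algebraMap k H c - T) * v) = 0 := hl ⟨v, hv, rfl⟩
    rw [sub_mul, map_sub, ← Algebra.smul_def, map_smul, smul_eq_mul] at this
    exact (sub_eq_zero.1 this).symm
  let L : BoundedEnd k W ⊗[k] H →ₗ[k] W := TensorProduct.lift
    (LinearMap.mk₂ k (fun φ h => l h • φ.1 m) (fun φ φ' h => by simp) (fun a φ h => smul_comm (l h) a (φ.1 m)) (fun φ h h' => by simp [add_smul]) (fun a φ h => by simp [mul_smul]))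
  have hL : ∀ φ h, L (φ ⊗ₜ h) = l h • φ.1 m := fun φ h => rfl
  have hL0 : L (u * (f ⊗ₜ[k] (1 : H) - (1 : BoundedEnd k W) ⊗ₜ[k] T)) = 0 := by
    rw [hs, Finset.sum_mul, map_sum]
    refine Finset.sum_eq_zero fun i hi => ?_
    have hiV : i.2 ∈ V := Submodule.subset_span 
      (Finset.mem_coe.2 (Finset.mem_image_of_mem _ hi))
    rw [mul_sub, map_sub, Algebra.TensorProduct.tmul_mul_tmul, Algebra.TensorProduct.tmul_mul_tmul,
      hL, hL, mul_one, mul_one, mul_comm i.2, hlV _ hiV, sub_eq_zero]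
    change l i.2 • i.1.1 (f.1 m) = _
    rw [hcm, map_smul, smul_smul, mul_comm]
  have hL1 := congr_arg L hg
  rw [map_sub, hL0, Algebra.TensorProduct.one_def, hL, map_sum, zero_sub] at hL1
  have hl1n : ‖l 1‖ = 1 := IsTriviallyNormed.norm_eq_one _ hl1
  have hmn : ‖m‖ ≤ C * ‖m‖ := by
    calc ‖m‖ = ‖-(l 1 • m)‖ := by rw [norm_neg, norm_smul, hl1n, one_mul]
      _ = ‖∑ i, L (ψ i ⊗ₜ g i)‖ := congr_arg _ hL1
      _ ≤ C * ‖m‖ := by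
        refine IsUltrametricDist.norm_sum_le_of_forall_le_of_nonneg (by positivity) fun i _ => ?_
        rw [hL, norm_smul]
        -- Any `k`-linear functional is contracting, because both `k` and `H` are trivially valued.
        have h2 : ‖l (g i)‖ ≤ ‖g i‖ := by
          rcases eq_or_ne (l (g i)) 0 with h0 | h0
          · rw [h0, norm_zero]; exact norm_nonneg _
          · rw [IsTriviallyNormed.norm_eq_one _ h0, hH]
            rintro h; simp [h] at h0
        calc ‖l (g i)‖ * ‖(ψ i).1 m‖ ≤ ‖g i‖ * (‖ψ i‖ * ‖m‖) :=
              mul_le_mul h2 (norm_apply_le _ _) (norm_nonneg _) (norm_nonneg _)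
          _ = (‖ψ i‖ * ‖g i‖) * ‖m‖ := by ring
          _ ≤ _ := mul_le_mul_of_nonneg_right (hle i) (norm_nonneg _)
  have : 0 < ‖m‖ := norm_pos_iff.2 hm
  nlinarith

end NotUnit

/-! ### Points of the affine line over a trivially valued field -/

section Points

variable {k : Type*} [NormedField k]

namespace AffineLine

lemma norm_eq_one_of_val (x : AffineLine k) (hx : ∀ P, x.val P = 0 ∨ x.val P = 1)
    (g : x.ResidueField) (hg : g ≠ 0) : ‖g‖ = 1 := by
  -- Unlike `g ≠ 0`, the condition of having norm `0` or `1` is closed, so it passes to the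
  -- completion.
  suffices h : ‖g‖ = 0 ∨ ‖g‖ = 1 from h.resolve_left (norm_ne_zero_iff.2 hg)
  have hq : ∀ q : k[X] ⧸ x.val.supp, x.val.onQuot le_rfl q = 0 ∨ x.val.onQuot le_rfl q = 1 := by
    intro q
    obtain ⟨P, rfl⟩ := Ideal.Quotient.mk_surjective q
    exact hx P
  have hz : ∀ z, x.fracVal z = 0 ∨ x.fracVal z = 1 := by
    intro z
    obtain ⟨a, s, hs, rfl⟩ := IsFractionRing.div_surjective (A := k[X] ⧸ x.val.supp) z
    rw [map_div₀, fracVal, Valuation.extendToLocalization_apply_map_apply,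
      Valuation.extendToLocalization_apply_map_apply]
    rcases hq a with ha | ha <;> rcases hq s with hs | hs <;> simp [ha, hs]
  clear hg
  refine UniformSpace.Completion.induction_on (α := WithAbs x.fracAbs)
    (p := fun g : x.ResidueField => ‖g‖ = 0 ∨ ‖g‖ = 1) g ?_ fun z => ?_
  · exact (isClosed_eq (f := fun g : x.ResidueField => ‖g‖) continuous_norm
      continuous_const).union (isClosed_eq (f := fun g : x.ResidueField => ‖g‖) continuous_norm
      continuous_const)
  · have h : ‖(show x.ResidueField from (z : UniformSpace.Completion (WithAbs x.fracAbs)))‖ =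
        x.fracVal (WithAbs.equiv x.fracAbs z) :=
      UniformSpace.Completion.norm_coe (E := WithAbs x.fracAbs) _
    rw [h]
    exact_mod_cast hz _

lemma character_X_sub_C (x : AffineLine k) (c : k) :
    x.character (Polynomial.X - Polynomial.C c) =
      x.character Polynomial.X - algebraMap k x.ResidueField c := map_sub _ _ _

lemma norm_character_X_sub (x : AffineLine k) (c : k) :
    ‖x.character Polynomial.X - algebraMap k x.ResidueField c‖ =
      x.val (Polynomial.X - Polynomial.C c) := by
  rw [← character_X_sub_C, norm_character]

lemma character_eq_aeval (x : AffineLine k) (P : k[X]) :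
    x.character P = Polynomial.aeval (x.character Polynomial.X) P := by
  induction P using Polynomial.induction_on' with
  | add p q hp hq => simp [hp, hq]
  | monomial n a =>
    rw [← Polynomial.C_mul_X_pow_eq_monomial]
    simp only [map_mul, map_pow, Polynomial.aeval_X, Polynomial.aeval_C]
    rfl

lemma val_eq_of_val_X_sub_C_eq_zero (x : AffineLine k) {c : k}
    (hx : x.val (Polynomial.X - Polynomial.C c) = 0) (P : k[X]) : x.val P = ‖P.eval c‖₊ := by
  have h : x.character Polynomial.X = algebraMap k x.ResidueField c := by
    rw [← sub_eq_zero, ← norm_eq_zero, norm_character_X_sub, hx]; rfl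
  have h2 : x.character P = x.character (Polynomial.C (P.eval c)) := by
    rw [character_eq_aeval, character_eq_aeval _ (Polynomial.C _), h, Polynomial.aeval_C,
      Polynomial.aeval_algebraMap_apply]
    rfl
  apply NNReal.eq
  rw [← norm_character, h2, norm_character, val_C]

variable [IsTriviallyNormed k]

lemma val_C_eq_one (x : AffineLine k) {a : k} (ha : a ≠ 0) : x.val (Polynomial.C a) = 1 := by
  rw [x.val_C]
  exact NNReal.eq (IsTriviallyNormed.norm_eq_one a ha)

/-- Over an algebraically closed field a polynomial is a constant times linear factors, so the
values on the latter determine the point. -/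
lemma val_eq_one_of_val_X_sub_C_eq_one [IsAlgClosed k] (x : AffineLine k)
    (hx : ∀ c, x.val (Polynomial.X - Polynomial.C c) = 1) {P : k[X]} (hP : P ≠ 0) :
    x.val P = 1 := by
  rw [(IsAlgClosed.splits P).eq_prod_roots, map_mul,
    x.val_C_eq_one (Polynomial.leadingCoeff_ne_zero.2 hP), map_multiset_prod, Multiset.map_map]
  simp [hx]

lemma val_X_sub_C_point_zero (c : k) :
    (point c 0).val (Polynomial.X - Polynomial.C c) = 0 := by
  apply NNReal.eq
  change Polynomial.gaussNorm _ _ _ = 0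
  simp

lemma val_X_sub_C_point_one (c : k) :
    (point (0 : k) 1).val (Polynomial.X - Polynomial.C c) = 1 := by
  apply NNReal.eq
  change Polynomial.gaussNorm (NormedField.toAbsoluteValue k) ((1 : ℝ≥0) : ℝ)
    (Polynomial.taylor 0 (Polynomial.X - Polynomial.C c)) = 1
  rw [Polynomial.taylor_zero]
  have hle : ∀ a : k, ‖a‖ ≤ 1 := fun a => by
    rcases eq_or_ne a 0 with rfl | ha
    · simp
    · exact (IsTriviallyNormed.norm_eq_one a ha).le
  refine le_antisymm ?_ ?_
  · obtain ⟨i, hi⟩ := Polynomial.exists_eq_gaussNorm (NormedField.toAbsoluteValue k)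
      ((1 : ℝ≥0) : ℝ) (Polynomial.X - Polynomial.C c)
    rw [hi, NNReal.coe_one, one_pow, mul_one]
    exact hle _
  · have h := Polynomial.le_gaussNorm (NormedField.toAbsoluteValue k)
      (Polynomial.X - Polynomial.C c) (c := ((1 : ℝ≥0) : ℝ)) zero_le_one 1
    simpa [Polynomial.coeff_C] using h

lemma eq_point_zero {x : AffineLine k} {c : k}
    (hx : x.val (Polynomial.X - Polynomial.C c) = 0) : x = point c 0 := by
  ext P
  rw [x.val_eq_of_val_X_sub_C_eq_zero hx,
    (point c 0).val_eq_of_val_X_sub_C_eq_zero (val_X_sub_C_point_zero c)]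

lemma eq_point_one [IsAlgClosed k] {x : AffineLine k}
    (hx : ∀ c, x.val (Polynomial.X - Polynomial.C c) = 1) : x = point 0 1 := by
  ext P
  rcases eq_or_ne P 0 with rfl | hP
  · simp
  rw [x.val_eq_one_of_val_X_sub_C_eq_one hx hP,
    (point 0 1).val_eq_one_of_val_X_sub_C_eq_one val_X_sub_C_point_one hP]

lemma val_X_sub_C_le_one {x : AffineLine k} (hx : x.val Polynomial.X ≤ 1) (c : k) :
    x.val (Polynomial.X - Polynomial.C c) ≤ 1 := by
  refine (Valuation.map_sub _ _ _).trans (max_le hx ?_)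
  rcases eq_or_ne c 0 with rfl | hc
  · simp
  · exact (x.val_C_eq_one hc).le

end AffineLine

end Points

end BerkSpec

end

/-! ### The spectrum of a regular singular module -/

open BerkSpec in
theorem mainTheorem2 {k : Type*} [NormedField k] [BerkSpec.IsTriviallyNormed k] [IsAlgClosed k]
    [CharZero k] (r : Set.Ioo (0 : ℝ) 1)
    {M : Type*} [AddCommGroup M] [Module k M] [Module k⸨X⸩ M] [IsScalarTower k k⸨X⸩ M]
    [Nontrivial M] (D : BerkSpec.Connection k M)
    {ι : Type*} [Fintype ι] [DecidableEq ι] (e : Module.Basis ι k⸨X⸩ M) (G : Matrix ι ι k)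
    (hG : D.matrix e = G.map HahnSeries.C)
    {κ : Type*} [Fintype κ] (b : Module.Basis κ k⸨X⸩ M) :
    BerkSpec.spectrum k (D.toBounded r b) =
      (⋃ a ∈ {a : k | Module.End.HasEigenvalue (Matrix.toLin' G) a},
        {x | ∃ n : ℤ, x = BerkSpec.AffineLine.point (a + n) 0}) ∪
      {BerkSpec.AffineLine.point 0 1} := by
  obtain ⟨C, hC⟩ := exists_norm_polyBounded_le r b e G
  -- Subtracting `c` from both `∇` and `T(x)` leaves the difference unchanged, so every case can be
  -- recentred at a convenient `c`.
  have hunit : ∀ (x : AffineLine k) (c : k), IsUnit (completedMap k x.ResidueField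
      (polyBounded r b e G) ((fun n : ℤ => Polynomial.X + Polynomial.C (n - c)) ⊗ₜ 1 -
        1 ⊗ₜ (x.character Polynomial.X - algebraMap k x.ResidueField c))) →
      x ∉ BerkSpec.spectrum k (D.toBounded r b) := by
    intro x c hx
    rw [BerkSpec.spectrum, Set.mem_ofPred_eq, not_not]
    convert hx using 1
    rw [← completedTensorHom_apply, map_sub, map_sub, completedMap_tmul, completedMap_tmul,
      ← map_sub, ← map_sub]
    congr 1
    have h1 : (fun n : ℤ => Polynomial.X + Polynomial.C (n - c) : ℤ → k[X]) =
        (fun n : ℤ => Polynomial.X + Polynomial.C (n : k)) - algebraMap k _ c := by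
      ext1 n
      simp [Polynomial.algebraMap_eq, add_sub_assoc]
    rw [h1, map_sub, polyBounded_eq_connection r b D e G hG, map_one, AlgHom.commutes,
      TensorProduct.sub_tmul, TensorProduct.tmul_sub, Algebra.algebraMap_eq_smul_one,
      Algebra.algebraMap_eq_smul_one, TensorProduct.smul_tmul]
    abel
  ext x
  constructor
  · intro hx
    by_contra hcon
    rw [Set.mem_union, not_or] at hcon
    obtain ⟨hcon1, hcon2⟩ := hcon
    rcases lt_or_ge 1 (x.val Polynomial.X) with h | h
    · refine hunit x 0 (isUnit_sub_of_one_lt_norm k _ hC _ ?_) hx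
      rw [x.norm_character_X_sub]
      simpa using h
    have hle := AffineLine.val_X_sub_C_le_one h
    obtain ⟨c, hc⟩ : ∃ c, x.val (Polynomial.X - Polynomial.C c) ≠ 1 := by
      by_contra! h1
      exact hcon2 (AffineLine.eq_point_one h1)
    have hc1 := lt_of_le_of_ne (hle c) hc
    by_cases hc0 : x.val (Polynomial.X - Polynomial.C c) = 0
    · refine hunit x c ?_ hx
      have hT : x.character Polynomial.X - algebraMap k x.ResidueField c = 0 := by
        rw [← norm_eq_zero, x.norm_character_X_sub, hc0]; rfl
      rw [hT]
      refine isUnit_tmul_one k _ ?_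
      have hcop : ∀ n : ℤ, IsCoprime (Polynomial.X + Polynomial.C (n - c)) G.charpoly := by
        intro n
        have : (Polynomial.X + Polynomial.C (n - c) : k[X]) =
          Polynomial.X - Polynomial.C (c - n) := by simp; ring
        rw [this, (Polynomial.irreducible_X_sub_C _).coprime_iff_not_dvd,
          Polynomial.dvd_iff_isRoot, ← Matrix.charpoly_toLin',
          ← Module.End.hasEigenvalue_iff_isRoot_charpoly]
        intro hev
        refine hcon1 (Set.mem_biUnion hev ⟨n, ?_⟩)
        rw [sub_add_cancel]
        exact AffineLine.eq_point_zero hc0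
      -- The Bézout coefficients are chosen independently for each `n`; the uniform bound makes the
      -- resulting family a bounded operator.
      choose R S hRS using hcop
      have : polyBounded r b e G
          (1 - (fun n : ℤ => Polynomial.X + Polynomial.C (n - c)) * R) = 0 := by
        refine polyBounded_eq_zero r b e G fun n => ⟨S n, ?_⟩
        simp only [Pi.sub_apply, Pi.one_apply, Pi.mul_apply]
        linear_combination -hRS n
      rw [map_sub, map_one, sub_eq_zero, map_mul] at this
      refine ⟨⟨_, _, this.symm, ?_⟩, rfl⟩
      rw [this, ← map_mul, ← map_mul, mul_comm]
    · choose R hR1 hR2 using fun n : ℤ => exists_drazin_inverse (Matrix.charpoly_monic G).ne_zero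
        le_rfl (n - c)
      refine hunit x c (isUnit_sub_of_drazin k _ hC (R := R) (d := G.charpoly.natDegree)
        (polyBounded_eq_zero r b e G hR1) (polyBounded_eq_zero r b e G hR2) ?_ ?_) hx
      · rw [← norm_ne_zero_iff, x.norm_character_X_sub]
        exact_mod_cast hc0
      · rw [x.norm_character_X_sub]
        exact_mod_cast hc1
  · rintro (hx | hx)
    · simp only [Set.mem_iUnion, Set.mem_ofPred_eq] at hx
      obtain ⟨a, ha, n, rfl⟩ := hx
      intro hU
      have h0 := AffineLine.val_X_sub_C_point_zero (a + n : k)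
      obtain ⟨V, -, hV⟩ := exists_finite_of_isUnit (AffineLine.norm_eq_one_of_val _ fun P => by
        rw [AffineLine.val_eq_of_val_X_sub_C_eq_zero _ h0]
        rcases eq_or_ne (P.eval (a + n)) 0 with h | h
        · simp [h]
        · exact Or.inr (NNReal.eq (IsTriviallyNormed.norm_eq_one _ h))) _ _ hU
      obtain ⟨m, hm, hDm⟩ := D.exists_eigenvector e G hG ha n
      obtain ⟨v, -, hv⟩ := hV (a + n) m hm hDm
      have hT : (AffineLine.point (a + n : k) 0).character Polynomial.X -
          algebraMap k _ (a + n : k) = 0 := by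
        rw [← norm_eq_zero, AffineLine.norm_character_X_sub, h0]; rfl
      rw [← neg_sub, hT] at hv
      simp at hv
    · rw [Set.mem_singleton_iff] at hx
      subst hx
      intro hU
      have hval : ∀ P : k[X], P ≠ 0 → (AffineLine.point (0 : k) 1).val P = 1 := fun P hP =>
        AffineLine.val_eq_one_of_val_X_sub_C_eq_one _ AffineLine.val_X_sub_C_point_one hP
      obtain ⟨V, hVfg, hV⟩ := exists_finite_of_isUnit (AffineLine.norm_eq_one_of_val _ fun P => by
        rcases eq_or_ne P 0 with rfl | h
        · simp
        · exact Or.inr (hval P h)) _ _ hU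
      -- `M ≠ 0` provides an eigenvalue `a` of `G`, hence the infinite family of eigenvalues `a + n`
      -- of `∇`.
      have : Nonempty ι := e.index_nonempty
      obtain ⟨a, ha⟩ := Module.End.exists_eigenvalue (Matrix.toLin' G)
      have htr : Transcendental k ((AffineLine.point (0 : k) 1).character Polynomial.X) := by
        rw [transcendental_iff]
        intro P hP
        by_contra hP0
        rw [← AffineLine.character_eq_aeval, ← norm_eq_zero, AffineLine.norm_character,
          hval P hP0] at hP
        simp at hP
      -- Characteristic zero makes the `a + n` distinct; the inverses of `T(x) - (a + n)` are
      -- independent by partial fractions, `T(x)` being transcendental.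
      have hli := htr.linearIndependent_sub_inv.comp (fun n : ℤ => a + (n : k)) (fun i j hij => by
        simpa using hij)
      have hmem : ∀ n : ℤ, ((AffineLine.point (0 : k) 1).character Polynomial.X -
          algebraMap k _ (a + (n : k)))⁻¹ ∈ V := by
        intro n
        obtain ⟨m, hm, hDm⟩ := D.exists_eigenvector e G hG ha n
        obtain ⟨v, hv, hv1⟩ := hV (a + n) m hm hDm
        rw [← neg_sub, neg_mul, ← mul_neg] at hv1
        rw [inv_eq_of_mul_eq_one_right hv1]
        exact V.neg_mem hv
      have : Module.Finite k V := Module.Finite.iff_fg.2 hVfg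
      have hli' : LinearIndependent k (fun n : ℤ => (⟨_, hmem n⟩ : V)) :=
        LinearIndependent.of_comp V.subtype hli
      have := hli'.finite
      exact not_finite ℤ
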